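/- Let $f$ be a neural network with layers $f_0,\dots,f_L$ ($f_L$ the lowest) and fixed parameter $\theta$, evaluated on a random data input $x=f_{L+1}$, and let $0\le l\le L$. Let $d\ge 1$, and let $f_l$ and $f_{l+1}$ take values in $\mathbb{R}^{d+1}$. Assume that the activation lengths are fixed, $\|f_{l+1}\|_2=c_{l+1}>0$ and $\|f_l\|_2=c_l>0$ almost surely, and that the random vectors $f_{l+1}$ and $f_l$ have probability density functions $p_{l+1}$ and $p_l$ with respect to surface measure on the $d$-dimensional hyperspheres of radii $c_{l+1}$ and $c_l$ about the origin. Assume that the layer function $f_l$ is almost surely differentiable at $f_{l+1}$, and let $\mathcal J$ be its Jacobian with respect to $f_{l+1}$ varying in the hypersphere, i.e. the restriction of its derivative at $f_{l+1}$ to the $d$-dimensional tangent space $f_{l+1}^{\perp}$. Let $s_1,\dots,s_d$ be the singular values of $\mathcal J$, let $\mu_{|s|}$ and $\sigma_{|s|}$ be their mean and (population) standard deviation, and put $$\|\mathcal J\|_{qm}=\sqrt{\tfrac1d\textstyle\sum_i s_i^2},\qquad GSC(l+1,l)=\frac{\|\mathcal J\|_{qm}\,\|f_{l+1}\|_2}{\|f_l\|_2}.$$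 For $k\in\{l,l+1\}$ let $H(f_k)=\mathbb E[-\log p_k(f_k)]$ be the entropy and $E(f_k)=\mathbb E[p_k(f_k)^{-1/d}]$ the exponential entropy. Let $\epsilon\ge 0$ and assume that $\sigma_{|s|}\ge\sqrt{\epsilon(\epsilon+2\mu_{|s|})}$ with probability at least $\delta$. (1) If $H(f_{l+1})$ and $H(f_l)$ exist and are finite, then $$\mathbb E\,GSC(l+1,l)\ \ge\ \frac{c_{l+1}}{c_l}\,\epsilon\delta+\exp\Big(\tfrac1d\big((H(f_l)-d\log c_l)-(H(f_{l+1})-d\log c_{l+1})\big)\Big).$$ (2) If the value $p_{l+1}(f_{l+1})$ of the density is independent of the singular values of $\mathcal J$, then $$\mathbb E\,GSC(l+1,l)\ \ge\ \frac{c_{l+1}}{c_l}\,\epsilon\delta+\frac{E(f_l)/c_l}{E(f_{l+1})/c_{l+1}}.$$ The expectations of the nonnegative quantities $GSC$ and $p_k(f_k)^{-1/d}$ are taken in $[0,\infty]$. -/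

import Mathlib

open MeasureTheory ProbabilityTheory
open scoped ENNReal

noncomputable section

/-! ### Singular value statistics of a linear map -/

section SingularValues

variable {V W : Type*} [NormedAddCommGroup V] [InnerProductSpace ℝ V] [FiniteDimensional ℝ V]
  [NormedAddCommGroup W] [InnerProductSpace ℝ W] [FiniteDimensional ℝ W]

/-- The quadratic mean norm: the root of the sum of the squared singular values divided by the
number of columns, i.e. by the dimension of the domain. (Singular values with an index beyond the
dimension of the domain or of the codomain vanish.) -/
def qmNorm (A : V →ₗ[ℝ] W) : ℝ :=
  √((∑ i ∈ Finset.range (Module.finrank ℝ V), A.singularValues i ^ 2) / Module.finrank ℝ V)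

/-- Mean of the singular values. -/
def meanSV (A : V →ₗ[ℝ] W) : ℝ :=
  (∑ i ∈ Finset.range (Module.finrank ℝ V), A.singularValues i) / Module.finrank ℝ V

/-- Standard deviation of the singular values. -/
def stdSV (A : V →ₗ[ℝ] W) : ℝ :=
  √((∑ i ∈ Finset.range (Module.finrank ℝ V), (A.singularValues i - meanSV A) ^ 2) /
      Module.finrank ℝ V)

end SingularValues

/-! ### Hyperspheres -/

/-- The surface area measure of the hypersphere of radius `c` about the origin of `ℝ ^ n`, as a
measure on `ℝ ^ n`: the surface measure of the unit sphere, pushed forward under scaling by `c`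
and multiplied by `c ^ (n - 1)`. -/
def sphereMeasure (n : ℕ) (c : ℝ) : Measure (EuclideanSpace ℝ (Fin n)) :=
  ENNReal.ofReal (c ^ (n - 1)) •
    Measure.map (fun u : Metric.sphere (0 : EuclideanSpace ℝ (Fin n)) 1 => c • u.1)
      (volume : Measure (EuclideanSpace ℝ (Fin n))).toSphere

/-- The tangent space at `v` of the hypersphere about the origin through `v`. -/
abbrev sphereTangent {n : ℕ} (v : EuclideanSpace ℝ (Fin n)) :
    Submodule ℝ (EuclideanSpace ℝ (Fin n)) :=
  (ℝ ∙ v)ᗮ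

/-- The Jacobian at `v` of the restriction of `g` to the hypersphere through `v`: the derivative
of `g` at `v`, restricted to the tangent space. -/
def sphereJacobian {n m : ℕ} (g : EuclideanSpace ℝ (Fin n) → EuclideanSpace ℝ (Fin m))
    (v : EuclideanSpace ℝ (Fin n)) : sphereTangent v →ₗ[ℝ] EuclideanSpace ℝ (Fin m) :=
  (fderiv ℝ g v : EuclideanSpace ℝ (Fin n) →ₗ[ℝ] EuclideanSpace ℝ (Fin m)) ∘ₗ
    (sphereTangent v).subtype

/-! ### Entropy and exponential entropy -/

section Entropy

variable {Ω E : Type*} [MeasurableSpace Ω] [MeasurableSpace E]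

/-- Minus the logarithm of the density `p` of `X` with respect to `ν`, evaluated at `X`. -/
def infoContent (X : Ω → E) (P : Measure Ω) (ν : Measure E) (ω : Ω) : ℝ :=
  -Real.log (pdf X P ν (X ω)).toReal

/-- The entropy `H(X) = 𝔼[- log p(X)]` is a finite expectation. -/
def HasEntropy (X : Ω → E) (P : Measure Ω) (ν : Measure E) : Prop :=
  Integrable (infoContent X P ν) P

/-- The entropy `H(X) = 𝔼[- log p(X)]`, where `p` is the density of `X` with respect to `ν`. -/
def entropy (X : Ω → E) (P : Measure Ω) (ν : Measure E) : ℝ :=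
  ∫ ω, infoContent X P ν ω ∂P

/-- The exponential entropy `E(X) = 𝔼[p(X) ^ (-1 / d)]` in dimension `d`, where `p` is the density
of `X` with respect to `ν`. -/
def expEntropy (d : ℕ) (X : Ω → E) (P : Measure Ω) (ν : Measure E) : ℝ≥0∞ :=
  ∫⁻ ω, pdf X P ν (X ω) ^ (-(1 / (d : ℝ))) ∂P

end Entropy

/-! ### Neural networks -/

/-- A neural network with layers `f_0, …, f_L`, `L = depth`, where `f_0` is the highest layer and
`f_L` the lowest one. The layer `f_l` takes a parameter `θ_l` (for `l = 0` this is the label) and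
the value of `f_{l+1}`, where `f_{L+1}` is the data input. Layers with index above `depth` play no
role. -/
structure NeuralNetwork where
  /-- The nominal depth `L`. -/
  depth : ℕ
  /-- The widths `d_0, …, d_{L+1}`. -/
  width : ℕ → ℕ
  /-- The space of parameters of a layer. -/
  Param : ℕ → Type
  /-- The layer functions. -/
  layer : (l : ℕ) → Param l →
    EuclideanSpace ℝ (Fin (width (l + 1))) → EuclideanSpace ℝ (Fin (width l))

namespace NeuralNetwork

variable (N : NeuralNetwork)

/-- The space of values of `f_l`. -/
abbrev Space (l : ℕ) : Type := EuclideanSpace ℝ (Fin (N.width l))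

/-- `f_l` as a function of `f_k`, `l ≤ k`: the composition `f_l ∘ f_{l+1} ∘ ⋯ ∘ f_{k-1}`. -/
def between (θ : ∀ l, N.Param l) (l k : ℕ) (h : l ≤ k) : N.Space k → N.Space l :=
  Nat.leRecOn (C := fun k => N.Space k → N.Space l) h
    (fun {k} g => g ∘ N.layer k (θ k)) id

theorem between_self (θ : ∀ l, N.Param l) (l : ℕ) : N.between θ l l le_rfl = id :=
  Nat.leRecOn_self _

theorem between_succ (θ : ∀ l, N.Param l) (l k : ℕ) (h : l ≤ k) :
    N.between θ l (k + 1) (Nat.le_succ_of_le h) = N.between θ l k h ∘ N.layer k (θ k) :=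
  Nat.leRecOn_succ h _

/-- The value of `f_l` on the data input `x`. -/
def act (θ : ∀ l, N.Param l) (l : ℕ) (h : l ≤ N.depth + 1) (x : N.Space (N.depth + 1)) :
    N.Space l :=
  N.between θ l (N.depth + 1) h x

/-- The Jacobian `J^l_k` of `f_l` with respect to `f_k` at the data input `x`, where `f_k` varies
in the hypersphere of vectors of its length. -/
def jacobian (θ : ∀ l, N.Param l) (k l : ℕ) (hlk : l ≤ k) (hk : k ≤ N.depth + 1)
    (x : N.Space (N.depth + 1)) : sphereTangent (N.act θ k hk x) →ₗ[ℝ] N.Space l :=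
  sphereJacobian (N.between θ l k hlk) (N.act θ k hk x)

/-- The gradient scale coefficient `GSC(k, l) = ‖J^l_k‖_qm ‖f_k‖ / ‖f_l‖` for activation vectors
that vary in hyperspheres. -/
def gsc (θ : ∀ l, N.Param l) (k l : ℕ) (hlk : l ≤ k) (hk : k ≤ N.depth + 1)
    (x : N.Space (N.depth + 1)) : ℝ :=
  qmNorm (N.jacobian θ k l hlk hk x) * ‖N.act θ k hk x‖ / ‖N.act θ l (hlk.trans hk) x‖

end NeuralNetwork

end

/-!
Let `X` have density `p` on the sphere of radius `a`, and let `f X` have density `q` on the sphere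
of radius `b`. The degree one homogeneous extension of `f` from the sphere is differentiable on the
cone over the points where `f` is, and the area formula for it, with a Hadamard bound for the
determinant of its derivative, gives `p(X) ≤ q(f X) * ∏ sᵢ` for the singular values `sᵢ` of the
Jacobian on the sphere. By AM–GM, `q(f X) ^ (-1/d) ≤ p(X) ^ (-1/d) * μ` with `μ` the mean of the
`sᵢ`; Jensen's inequality for `exp` turns this into a bound of `𝔼 μ` by entropies, and independence
turns it into one by exponential entropies. Finally the square of the quadratic mean is `μ² + σ²`,
so that `σ ≥ √(ε(ε + 2μ))` forces the quadratic mean to be at least `μ + ε`.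
-/

section SingularValues

variable {V W : Type*} [NormedAddCommGroup V] [InnerProductSpace ℝ V] [FiniteDimensional ℝ V]
  [NormedAddCommGroup W] [InnerProductSpace ℝ W] [FiniteDimensional ℝ W]

theorem meanSV_nonneg (A : V →ₗ[ℝ] W) : 0 ≤ meanSV A :=
  div_nonneg (Finset.sum_nonneg fun i _ => A.singularValues_nonneg i) (Nat.cast_nonneg _)

theorem qmNorm_nonneg (A : V →ₗ[ℝ] W) : 0 ≤ qmNorm A := Real.sqrt_nonneg _

theorem stdSV_nonneg (A : V →ₗ[ℝ] W) : 0 ≤ stdSV A := Real.sqrt_nonneg _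

theorem qmNorm_sq [Nontrivial V] (A : V →ₗ[ℝ] W) :
    qmNorm A ^ 2 = meanSV A ^ 2 + stdSV A ^ 2 := by
  have hd : (Module.finrank ℝ V : ℝ) ≠ 0 := Nat.cast_ne_zero.2 Module.finrank_pos.ne'
  have hsum : ∑ i ∈ Finset.range (Module.finrank ℝ V), A.singularValues i =
      meanSV A * Module.finrank ℝ V := by rw [meanSV, div_mul_cancel₀ _ hd]
  rw [qmNorm, stdSV, Real.sq_sqrt (by positivity), Real.sq_sqrt (by positivity)]
  simp only [sub_sq, Finset.sum_add_distrib, Finset.sum_sub_distrib, ← Finset.sum_mul,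
    ← Finset.mul_sum, hsum, Finset.sum_const, Finset.card_range, nsmul_eq_mul]
  field_simp
  ring

theorem meanSV_le_qmNorm [Nontrivial V] (A : V →ₗ[ℝ] W) : meanSV A ≤ qmNorm A :=
  le_of_sq_le_sq (by rw [qmNorm_sq]; exact le_add_of_nonneg_right (sq_nonneg _)) (qmNorm_nonneg A)

theorem add_meanSV_le_qmNorm [Nontrivial V] (A : V →ₗ[ℝ] W) {ε : ℝ}
    (h : √(ε * (ε + 2 * meanSV A)) ≤ stdSV A) : ε + meanSV A ≤ qmNorm A := by
  have hvar : ε * (ε + 2 * meanSV A) ≤ stdSV A ^ 2 := (Real.sqrt_le_left (stdSV_nonneg A)).1 h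
  refine le_of_sq_le_sq ?_ (qmNorm_nonneg A)
  linarith [qmNorm_sq A]

theorem normDet_rpow_le_meanSV [Nontrivial V] (A : V →ₗ[ℝ] W) :
    A.normDet ^ (1 / (Module.finrank ℝ V : ℝ)) ≤ meanSV A := by
  have h := Real.geom_mean_le_arith_mean (Finset.range (Module.finrank ℝ V)) (fun _ => 1)
    A.singularValues (fun _ _ => zero_le_one) (by simpa using Module.finrank_pos)
    (fun i _ => A.singularValues_nonneg i)
  simpa [A.normDet_eq_prod_singularValues, meanSV] using h

theorem exists_orthonormalBasis_norm_apply_sq_eq_sum (A : V →ₗ[ℝ] W) :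
    ∃ e : OrthonormalBasis (Fin (Module.finrank ℝ V)) ℝ V,
      ∀ x, ‖A x‖ ^ 2 = ∑ i : Fin _, (A.singularValues i * inner ℝ (e i) x) ^ 2 := by
  have hsymm := A.isSymmetric_adjoint_comp_self
  refine ⟨hsymm.eigenvectorBasis rfl, fun x => ?_⟩
  rw [← real_inner_self_eq_norm_sq, ← LinearMap.adjoint_inner_left, ← LinearMap.comp_apply,
    ← (hsymm.eigenvectorBasis rfl).sum_inner_mul_inner]
  refine Finset.sum_congr rfl fun i _ => ?_
  rw [hsymm, hsymm.apply_eigenvectorBasis, ← A.sq_singularValues_fin rfl,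
    real_inner_smul_right, RCLike.ofReal_real_eq_id, id_eq, real_inner_comm]
  ring

theorem exists_ne_zero_singularValues_mul_norm_le {W' : Type*} [AddCommGroup W'] [Module ℝ W']
    (A : V →ₗ[ℝ] W) (R : V →ₗ[ℝ] W') {k : ℕ} (hk : k < Module.finrank ℝ V)
    (hR : Module.finrank ℝ R.range ≤ k) :
    ∃ x ≠ 0, R x = 0 ∧ A.singularValues k * ‖x‖ ≤ ‖A x‖ := by
  obtain ⟨e, he⟩ := exists_orthonormalBasis_norm_apply_sq_eq_sum A
  let coords : V →ₗ[ℝ] Finset.Ioi (⟨k, hk⟩ : Fin (Module.finrank ℝ V)) → ℝ :=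
    LinearMap.pi fun i => innerₛₗ ℝ (e i)
  have hker : (R.rangeRestrict.prod coords).ker ≠ ⊥ := by
    refine LinearMap.ker_ne_bot_of_finrank_lt ?_
    simp only [Module.finrank_prod, Module.finrank_fintype_fun_eq_card, Fintype.card_coe,
      Fin.card_Ioi]
    omega
  obtain ⟨x, hx, hx0⟩ := Submodule.exists_mem_ne_zero_of_ne_bot hker
  rw [LinearMap.ker_prod, Submodule.mem_inf, LinearMap.ker_rangeRestrict] at hx
  refine ⟨x, hx0, hx.1, le_of_sq_le_sq ?_ (norm_nonneg _)⟩
  rw [mul_pow, he, ← e.sum_sq_norm_inner_right, Finset.mul_sum]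
  refine Finset.sum_le_sum fun i _ => ?_
  rw [Real.norm_eq_abs, sq_abs, mul_pow]
  obtain hik | hki := le_or_gt i ⟨k, hk⟩
  · gcongr
    · exact A.singularValues_nonneg k
    · exact A.singularValues_antitone hik
  · have : inner ℝ (e i) x = 0 := congrFun hx.2 ⟨i, Finset.mem_Ioi.2 hki⟩
    simp [this]

theorem exists_finrank_range_le_norm_sub_le (A : V →ₗ[ℝ] W) (k : ℕ) :
    ∃ R : V →ₗ[ℝ] W, Module.finrank ℝ R.range ≤ k ∧
      ∀ x, ‖A x - R x‖ ≤ A.singularValues k * ‖x‖ := by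
  obtain ⟨e, he⟩ := exists_orthonormalBasis_norm_apply_sq_eq_sum A
  let S : Submodule ℝ V := Submodule.span ℝ (Set.range fun i : {i : Fin _ // i.val < k} => e i.1)
  have hS : Module.finrank ℝ S ≤ k :=
    (finrank_range_le_card _).trans <| (Fintype.card_fin k).le.trans' <|
      Fintype.card_le_of_injective (fun i => ⟨i, i.2⟩) fun i j hij => by
        simpa [Subtype.ext_iff, Fin.ext_iff] using hij
  have horth (i : Fin (Module.finrank ℝ V)) (hi : k ≤ i) : e i ∈ Sᗮ := by
    refine (Submodule.isOrtho_span (s := {e i})).2 ?_ (Submodule.mem_span_singleton_self _)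
    rintro _ rfl _ ⟨j, rfl⟩
    exact e.orthonormal.2 fun hij => (hij ▸ j.2).not_ge hi
  refine ⟨A ∘ₗ S.starProjection.toLinearMap, ?_, fun x => le_of_sq_le_sq ?_ ?_⟩
  · rw [LinearMap.range_comp]
    refine (Submodule.finrank_map_le _ _).trans ?_
    rwa [Submodule.range_starProjection]
  · rw [LinearMap.comp_apply, ← map_sub, he, mul_pow, ← e.sum_sq_norm_inner_right, Finset.mul_sum]
    refine Finset.sum_le_sum fun i _ => ?_
    rw [Real.norm_eq_abs, sq_abs, mul_pow]
    obtain hik | hki := lt_or_ge (i : ℕ) k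
    · have hei : e i ∈ S := Submodule.subset_span ⟨⟨i, hik⟩, rfl⟩
      rw [ContinuousLinearMap.coe_coe, Submodule.inner_right_of_mem_orthogonal hei
        (Submodule.sub_starProjection_mem_orthogonal x), zero_pow two_ne_zero, mul_zero]
      positivity
    · rw [inner_sub_right, ContinuousLinearMap.coe_coe,
        Submodule.inner_left_of_mem_orthogonal (Submodule.starProjection_apply_mem S x)
          (horth i hki), sub_zero]
      gcongr
      · exact A.singularValues_nonneg i
      · exact A.singularValues_antitone hki
  · exact mul_nonneg (A.singularValues_nonneg k) (norm_nonneg x)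

end SingularValues

/- Eckart–Young, with `A` precomposed with the projection onto `V` so that the space of maps no
longer depends on `V`; the distance is continuous, whence singular values are measurable in
`(A, V)`. -/
theorem singularValues_comp_subtype_eq_infDist {E W : Type*} [NormedAddCommGroup E]
    [InnerProductSpace ℝ E] [FiniteDimensional ℝ E] [NormedAddCommGroup W] [InnerProductSpace ℝ W]
    [FiniteDimensional ℝ W] (A : E →L[ℝ] W) (V : Submodule ℝ E) (k : ℕ) :
    (A.toLinearMap ∘ₗ V.subtype).singularValues k =
      Metric.infDist (A ∘L V.starProjection) {R | Module.finrank ℝ R.toLinearMap.range ≤ k} := by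
  refine le_antisymm ?_ ?_
  · have h0 : Module.finrank ℝ (0 : E →L[ℝ] W).toLinearMap.range ≤ k := by
      rw [ContinuousLinearMap.toLinearMap_zero, LinearMap.range_zero, finrank_bot]
      exact k.zero_le
    refine (Metric.le_infDist ⟨0, h0⟩).2 fun R hR => ?_
    obtain hk | hk := le_or_gt (Module.finrank ℝ V) k
    · rw [LinearMap.singularValues_of_finrank_le _ hk]
      exact dist_nonneg
    · have hRV : Module.finrank ℝ (R.toLinearMap ∘ₗ V.subtype).range ≤ k :=
        (Submodule.finrank_mono (LinearMap.range_comp_le_range _ _)).trans hR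
      obtain ⟨x, hx0, hRx, hx⟩ :=
        exists_ne_zero_singularValues_mul_norm_le (A.toLinearMap ∘ₗ V.subtype) _ hk hRV
      refine le_of_mul_le_mul_right (hx.trans ?_) (norm_pos_iff.2 hx0)
      rw [dist_eq_norm]
      refine le_of_eq_of_le ?_ ((A ∘L V.starProjection - R).le_opNorm x)
      simp [show R x = 0 from hRx]
  · obtain ⟨R, hR, hAR⟩ := exists_finrank_range_le_norm_sub_le (A.toLinearMap ∘ₗ V.subtype) k
    let R' : E →L[ℝ] W := R.toContinuousLinearMap ∘L V.orthogonalProjectionOnto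
    have hR' : R' ∈ {R : E →L[ℝ] W | Module.finrank ℝ R.toLinearMap.range ≤ k} :=
      (Submodule.finrank_mono (LinearMap.range_comp_le_range _ _)).trans hR
    refine (Metric.infDist_le_dist_of_mem hR').trans ?_
    rw [dist_eq_norm]
    refine ContinuousLinearMap.opNorm_le_bound _ (LinearMap.singularValues_nonneg _ k) fun x => ?_
    refine (hAR (V.orthogonalProjectionOnto x)).trans ?_
    gcongr
    · exact LinearMap.singularValues_nonneg _ k
    · exact V.norm_orthogonalProjectionOnto_apply_le x

section Measurability

variable {n m : ℕ}

theorem finrank_sphereTangent {v : EuclideanSpace ℝ (Fin n)} (hv : v ≠ 0) :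
    Module.finrank ℝ (sphereTangent v) = n - 1 := by
  have h := (ℝ ∙ v).finrank_add_finrank_orthogonal
  rw [finrank_span_singleton hv, finrank_euclideanSpace_fin] at h
  exact Nat.eq_sub_of_add_eq' h

theorem nontrivial_sphereTangent (hn : 1 < n) {v : EuclideanSpace ℝ (Fin n)} (hv : v ≠ 0) :
    Nontrivial (sphereTangent v) :=
  Module.nontrivial_of_finrank_pos (R := ℝ) (by rw [finrank_sphereTangent hv]; lia)

theorem measurable_starProjection_sphereTangent :
    Measurable fun v : EuclideanSpace ℝ (Fin n) => (sphereTangent v).starProjection := by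
  have hproj (v : EuclideanSpace ℝ (Fin n)) : (sphereTangent v).starProjection =
      ContinuousLinearMap.id ℝ _ - (‖v‖ ^ 2)⁻¹ • (innerSL ℝ v).smulRight v := by
    ext1 w
    rw [Submodule.starProjection_orthogonal_val, Submodule.starProjection_singleton]
    simp [smul_smul, div_eq_inv_mul]
  simp only [hproj]
  have hsmulRight : Continuous fun v : EuclideanSpace ℝ (Fin n) => (innerSL ℝ v).smulRight v := by
    fun_prop
  exact ((by fun_prop : Measurable fun v : EuclideanSpace ℝ (Fin n) =>
    (‖v‖ ^ 2)⁻¹).smul hsmulRight.measurable).const_sub _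

theorem measurable_singularValues_sphereJacobian
    (g : EuclideanSpace ℝ (Fin n) → EuclideanSpace ℝ (Fin m)) (k : ℕ) :
    Measurable fun v => (sphereJacobian g v).singularValues k := by
  simp only [sphereJacobian, singularValues_comp_subtype_eq_infDist]
  refine (Metric.continuous_infDist_pt _).measurable.comp ?_
  exact isBoundedBilinearMap_comp.continuous.measurable.comp
    ((measurable_fderiv ℝ g).prodMk measurable_starProjection_sphereTangent)

theorem measurable_comp_singularValues_sphereJacobian {β : Type*} [MeasurableSpace β]
    (g : EuclideanSpace ℝ (Fin n) → EuclideanSpace ℝ (Fin m)) {Φ : ℕ → (ℕ → ℝ) → β}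
    (hΦ : ∀ d, Measurable (Φ d)) :
    Measurable fun v =>
      Φ (Module.finrank ℝ (sphereTangent v)) (sphereJacobian g v).singularValues := by
  refine (measurable_from_prod_countable_right (f := Function.uncurry Φ) hΦ).comp
    (Measurable.prodMk ?_ (measurable_pi_lambda _ (measurable_singularValues_sphereJacobian g)))
  refine measurable_of_measurable_on_compl_singleton 0 ?_
  convert! measurable_const (a := n - 1) with v
  exact finrank_sphereTangent v.2

theorem measurable_meanSV_sphereJacobian
    (g : EuclideanSpace ℝ (Fin n) → EuclideanSpace ℝ (Fin m)) :
    Measurable fun v => meanSV (sphereJacobian g v) :=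
  measurable_comp_singularValues_sphereJacobian g
    (Φ := fun d s => (∑ i ∈ Finset.range d, s i) / d) fun _ => by fun_prop

theorem measurable_stdSV_sphereJacobian
    (g : EuclideanSpace ℝ (Fin n) → EuclideanSpace ℝ (Fin m)) :
    Measurable fun v => stdSV (sphereJacobian g v) :=
  measurable_comp_singularValues_sphereJacobian g
    (Φ := fun d s => √((∑ i ∈ Finset.range d, (s i - (∑ j ∈ Finset.range d, s j) / d) ^ 2) / d))
    fun _ => by fun_prop

theorem measurable_normDet_sphereJacobian
    (g : EuclideanSpace ℝ (Fin n) → EuclideanSpace ℝ (Fin m)) :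
    Measurable fun v => (sphereJacobian g v).normDet := by
  simp only [LinearMap.normDet_eq_prod_singularValues]
  exact measurable_comp_singularValues_sphereJacobian g
    (Φ := fun d s => ∏ i ∈ Finset.range d, s i) fun _ => by fun_prop

end Measurability

theorem abs_det_le_prod_norm {n : ℕ} {E : Type*} [NormedAddCommGroup E] [InnerProductSpace ℝ E]
    (e : OrthonormalBasis (Fin n) ℝ E) (M : E →ₗ[ℝ] E) :
    |LinearMap.det M| ≤ ∏ i, ‖M (e i)‖ := by
  have : Fact (Module.finrank ℝ E = n) := ⟨by simpa using Module.finrank_eq_card_basis e.toBasis⟩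
  have h := e.toBasis.orientation.abs_volumeForm_apply_le (M ∘ e)
  rwa [e.toBasis.orientation.volumeForm_robust e rfl, ← e.coe_toBasis, e.toBasis.det_comp,
    e.toBasis.det_self, mul_one] at h

theorem exists_orthonormalBasis_zero_eq_succ_eq {n : ℕ} {E : Type*} [NormedAddCommGroup E]
    [InnerProductSpace ℝ E] [FiniteDimensional ℝ E] {u : E} (hu : ‖u‖ = 1)
    (e : OrthonormalBasis (Fin n) ℝ (ℝ ∙ u)ᗮ) :
    ∃ b : OrthonormalBasis (Fin (n + 1)) ℝ E, b 0 = u ∧ ∀ i : Fin n, b i.succ = e i := by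
  let b : Fin (n + 1) → E := Fin.cons u fun i => (e i : E)
  have hue (i : Fin n) : inner ℝ u (e i : E) = 0 :=
    Submodule.mem_orthogonal_singleton_iff_inner_right.1 (e i).2
  have hb : Orthonormal ℝ b := by
    rw [orthonormal_iff_ite]
    intro i j
    cases i using Fin.cases <;> cases j using Fin.cases
    · simp [b, hu]
    · simpa [b, (Fin.succ_ne_zero _).symm] using hue _
    · simpa [b, real_inner_comm] using hue _
    · simpa [b] using orthonormal_iff_ite.1 e.orthonormal _ _
  have hcard : Fintype.card (Fin (n + 1)) = Module.finrank ℝ E := by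
    rw [← (ℝ ∙ u).finrank_add_finrank_orthogonal, Module.finrank_eq_card_basis e.toBasis,
      finrank_span_singleton (norm_ne_zero_iff.1 (hu ▸ one_ne_zero)), Fintype.card_fin,
      Fintype.card_fin, add_comm]
  refine ⟨(basisOfOrthonormalOfCardEqFinrank hb hcard).toOrthonormalBasis (by simpa using hb),
    by simp [b], fun i => by simp [b]⟩

theorem exists_orthonormalBasis_normDet_eq_prod_norm {V W : Type*} [NormedAddCommGroup V]
    [InnerProductSpace ℝ V] [FiniteDimensional ℝ V] [NormedAddCommGroup W] [InnerProductSpace ℝ W]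
    [FiniteDimensional ℝ W] (A : V →ₗ[ℝ] W) :
    ∃ e : OrthonormalBasis (Fin (Module.finrank ℝ V)) ℝ V, A.normDet = ∏ i, ‖A (e i)‖ := by
  obtain ⟨e, he⟩ := exists_orthonormalBasis_norm_apply_sq_eq_sum A
  refine ⟨e, ?_⟩
  rw [A.normDet_eq_prod_singularValues, Finset.prod_range]
  refine Finset.prod_congr rfl fun i _ => ?_
  rw [← sq_eq_sq₀ (A.singularValues_nonneg i) (norm_nonneg _), he]
  simp [e.inner_eq_ite]

theorem abs_det_mul_norm_le {E : Type*} [NormedAddCommGroup E] [InnerProductSpace ℝ E]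
    [FiniteDimensional ℝ E] (M : E →ₗ[ℝ] E) (v : E) :
    |LinearMap.det M| * ‖v‖ ≤ ‖M v‖ * (M ∘ₗ (ℝ ∙ v)ᗮ.subtype).normDet := by
  obtain rfl | hv := eq_or_ne v 0
  · simp
  have hu : ‖‖v‖⁻¹ • v‖ = 1 := norm_smul_inv_norm (𝕜 := ℝ) hv
  have hspan : (ℝ ∙ ‖v‖⁻¹ • v) = ℝ ∙ v :=
    Submodule.span_singleton_smul_eq (IsUnit.mk0 _ (inv_ne_zero (norm_ne_zero_iff.2 hv))) v
  rw [← hspan]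
  obtain ⟨e, he⟩ := exists_orthonormalBasis_normDet_eq_prod_norm
    (M ∘ₗ (ℝ ∙ ‖v‖⁻¹ • v)ᗮ.subtype)
  obtain ⟨b, hb0, hbs⟩ := exists_orthonormalBasis_zero_eq_succ_eq hu e
  have hdet := abs_det_le_prod_norm b M
  rw [Fin.prod_univ_succ, hb0, map_smul, norm_smul, norm_inv, norm_norm] at hdet
  simp only [hbs] at hdet
  rwa [he, ← le_div_iff₀ (norm_pos_iff.2 hv), mul_div_right_comm, div_eq_inv_mul]

section RadialProjection

variable {E : Type*} [NormedAddCommGroup E] [NormedSpace ℝ E]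

/-- The radial projection of the punctured space onto the sphere of radius `c` about the origin.
It sends the origin to itself. -/
noncomputable def radialProj (c : ℝ) (z : E) : E :=
  (c / ‖z‖) • z

/-- The open cone, without its apex `0`, over the part of the sphere of radius `c` that lies
in `s`. -/
def sphereCone (c : ℝ) (s : Set E) : Set E :=
  radialProj c ⁻¹' s ∩ (Metric.ball 0 c \ {0})

theorem norm_radialProj {c : ℝ} (hc : 0 ≤ c) {z : E} (hz : z ≠ 0) : ‖radialProj c z‖ = c := by
  rw [radialProj, norm_smul, norm_div, norm_norm, Real.norm_of_nonneg hc,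
    div_mul_cancel₀ _ (norm_ne_zero_iff.2 hz)]

theorem radialProj_smul {c r : ℝ} (hr : 0 < r) {v : E} (hv : ‖v‖ = c) :
    radialProj c (r • v) = v := by
  obtain rfl | hv0 := eq_or_ne v 0
  · rw [radialProj, smul_zero, smul_zero]
  have hv' : ‖v‖ ≠ 0 := norm_ne_zero_iff.2 hv0
  have hone : ‖v‖ / (r * ‖v‖) * r = 1 := by field_simp
  rw [radialProj, norm_smul, Real.norm_of_nonneg hr.le, smul_smul, ← hv, hone, one_smul]

theorem norm_div_smul_radialProj {c : ℝ} (hc : 0 < c) (z : E) :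
    (‖z‖ / c) • radialProj c z = z := by
  obtain rfl | hz := eq_or_ne z 0
  · simp [radialProj]
  · rw [radialProj, smul_smul, div_mul_div_cancel₀ hc.ne',
      div_self (norm_ne_zero_iff.2 hz), one_smul]

theorem measurable_radialProj [MeasurableSpace E] [BorelSpace E] (c : ℝ) :
    Measurable (radialProj (E := E) c) :=
  (measurable_norm.const_div c).smul measurable_id

theorem measurableSet_sphereCone [MeasurableSpace E] [BorelSpace E] (c : ℝ) {s : Set E}
    (hs : MeasurableSet s) : MeasurableSet (sphereCone c s) :=
  (measurable_radialProj c hs).inter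
    (Metric.isOpen_ball.measurableSet.diff (measurableSet_singleton 0))

open scoped Pointwise in
theorem sphereCone_eq_smul {c : ℝ} (hc : 0 < c) (s : Set E) :
    sphereCone c s = c • (Set.Ioo (0 : ℝ) 1 •
      (Subtype.val '' ((fun u : Metric.sphere (0 : E) 1 => c • u.1) ⁻¹' s))) := by
  refine Set.Subset.antisymm (fun z ⟨hzs, hzc, hz0⟩ => ?_) ?_
  · have hz' : 0 < ‖z‖ := norm_pos_iff.2 hz0
    rw [mem_ball_zero_iff] at hzc
    have hu : ‖‖z‖⁻¹ • z‖ = 1 := norm_smul_inv_norm (𝕜 := ℝ) hz0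
    refine ⟨(‖z‖ / c) • ‖z‖⁻¹ • z, ⟨‖z‖ / c, ⟨by positivity, (div_lt_one hc).2 hzc⟩, _,
      ⟨⟨‖z‖⁻¹ • z, mem_sphere_zero_iff_norm.2 hu⟩, ?_, rfl⟩, rfl⟩, ?_⟩
    · rwa [Set.mem_preimage, smul_smul, ← div_eq_mul_inv]
    · change c • (‖z‖ / c) • ‖z‖⁻¹ • z = z
      rw [smul_smul, smul_smul, mul_div_cancel₀ _ hc.ne', mul_inv_cancel₀ hz'.ne', one_smul]
  · rintro _ ⟨_, ⟨r, ⟨hr0, hr1⟩, _, ⟨u, hu, rfl⟩, rfl⟩, rfl⟩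
    have hcu : ‖c • u.1‖ = c := by simp [norm_smul, hc.le]
    change c • r • u.1 ∈ _
    rw [smul_comm]
    refine ⟨?_, ?_, smul_ne_zero hr0.ne' (norm_ne_zero_iff.1 (hcu.trans_ne hc.ne'))⟩
    · rwa [Set.mem_preimage, radialProj_smul hr0 hcu]
    · rw [mem_ball_zero_iff, norm_smul, hcu, Real.norm_of_nonneg hr0.le]
      exact mul_lt_of_lt_one_left hc hr1

variable {F : Type*} [NormedAddCommGroup F] [NormedSpace ℝ F]

/-- The positively homogeneous extension, of degree one, of the restriction of `f` to the sphere
of radius `c`. -/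
noncomputable def radialExt (f : E → F) (c : ℝ) (z : E) : F :=
  (‖z‖ / c) • f (radialProj c z)

theorem sphereCone_image_subset {f : E → F} {a b : ℝ} (ha : 0 < a) (hb : 0 < b) {s : Set E}
    (hs : ∀ v ∈ s, ‖v‖ = a) :
    sphereCone b (f '' s) ⊆ radialExt f a '' sphereCone a s := by
  rintro y ⟨⟨v, hv, hvy⟩, hyb, hy0⟩
  have hr : 0 < ‖y‖ / b := div_pos (norm_pos_iff.2 hy0) hb
  have hnorm : ‖(‖y‖ / b) • v‖ = ‖y‖ / b * a := by
    rw [norm_smul, hs v hv, Real.norm_of_nonneg hr.le]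
  have hproj : radialProj a ((‖y‖ / b) • v) = v := radialProj_smul hr (hs v hv)
  refine ⟨(‖y‖ / b) • v, ⟨?_, ?_, ?_⟩, ?_⟩
  · rwa [Set.mem_preimage, hproj]
  · rw [mem_ball_zero_iff, hnorm]
    exact mul_lt_of_lt_one_left ha ((div_lt_one hb).2 (mem_ball_zero_iff.1 hyb))
  · exact norm_ne_zero_iff.1 (hnorm.trans_ne (mul_pos hr ha).ne')
  · rw [radialExt, hproj, hnorm, mul_div_cancel_right₀ _ ha.ne', hvy,
      norm_div_smul_radialProj hb]

end RadialProjection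

section SphereMeasure

variable {n : ℕ} {c : ℝ}

theorem sphereMeasure_eq_smul_map_radialProj (hc : 0 < c) :
    sphereMeasure n c = ENNReal.ofReal (n / c) •
      (volume.restrict (Metric.ball 0 c \ {0})).map (radialProj c) := by
  have hsmul : Measurable fun u : Metric.sphere (0 : EuclideanSpace ℝ (Fin n)) 1 => c • u.1 :=
    measurable_subtype_coe.const_smul c
  ext s hs
  rw [sphereMeasure, Measure.smul_apply, Measure.smul_apply, Measure.map_apply hsmul hs,
    Measure.toSphere_apply' _ (hsmul hs), Measure.map_apply (measurable_radialProj c) hs,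
    Measure.restrict_apply (measurable_radialProj c hs), ← sphereCone, sphereCone_eq_smul hc,
    Measure.addHaar_smul, finrank_euclideanSpace_fin, abs_of_pos (pow_pos hc n)]
  simp only [smul_eq_mul, ← mul_assoc]
  congr 1
  rw [← ENNReal.ofReal_natCast, ← ENNReal.ofReal_mul (by positivity),
    ← ENNReal.ofReal_mul (by positivity)]
  congr 1
  cases n with
  | zero => simp
  | succ n => rw [Nat.add_sub_cancel, pow_succ]; field_simp

theorem sphereMeasure_apply (hc : 0 < c) {s : Set (EuclideanSpace ℝ (Fin n))}
    (hs : MeasurableSet s) :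
    sphereMeasure n c s = ENNReal.ofReal (n / c) * volume (sphereCone c s) := by
  rw [sphereMeasure_eq_smul_map_radialProj hc, Measure.smul_apply,
    Measure.map_apply (measurable_radialProj c) hs,
    Measure.restrict_apply (measurable_radialProj c hs), sphereCone, smul_eq_mul]

theorem setLIntegral_sphereMeasure (hc : 0 < c) {s : Set (EuclideanSpace ℝ (Fin n))}
    (hs : MeasurableSet s) {f : EuclideanSpace ℝ (Fin n) → ℝ≥0∞} (hf : Measurable f) :
    ∫⁻ v in s, f v ∂sphereMeasure n c =
      ENNReal.ofReal (n / c) * ∫⁻ z in sphereCone c s, f (radialProj c z) := by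
  rw [sphereMeasure_eq_smul_map_radialProj hc, Measure.restrict_smul, lintegral_smul_measure,
    setLIntegral_map hs hf (measurable_radialProj c),
    Measure.restrict_restrict (measurable_radialProj c hs), sphereCone, smul_eq_mul]

instance isFiniteMeasure_sphereMeasure (n : ℕ) (c : ℝ) : IsFiniteMeasure (sphereMeasure n c) := by
  refine ⟨?_⟩
  rw [sphereMeasure, Measure.smul_apply, smul_eq_mul]
  exact ENNReal.mul_lt_top ENNReal.ofReal_lt_top (measure_lt_top _ _)

end SphereMeasure

section RadialDerivative

variable {E F : Type*} [NormedAddCommGroup E] [InnerProductSpace ℝ E] [NormedAddCommGroup F]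
  [NormedSpace ℝ F]

theorem hasFDerivAt_norm {z : E} (hz : z ≠ 0) :
    HasFDerivAt (fun z : E => ‖z‖) (‖z‖⁻¹ • innerSL ℝ z) z := by
  have h := (hasStrictFDerivAt_norm_sq z).hasFDerivAt.sqrt
    (pow_ne_zero 2 (norm_ne_zero_iff.2 hz))
  simp only [Real.sqrt_sq (norm_nonneg _)] at h
  refine h.congr_fderiv ?_
  rw [← Nat.cast_smul_eq_nsmul ℝ, smul_smul]
  congr 1
  push_cast
  field_simp

theorem hasFDerivAt_radialProj (c : ℝ) {z : E} (hz : z ≠ 0) :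
    HasFDerivAt (radialProj c) ((c / ‖z‖) • (ℝ ∙ z)ᗮ.starProjection) z := by
  have hz' : ‖z‖ ≠ 0 := norm_ne_zero_iff.2 hz
  refine ((((hasDerivAt_inv hz').comp_hasFDerivAt z (hasFDerivAt_norm hz)).const_mul
    c).smul (hasFDerivAt_id z)).congr_fderiv ?_
  ext1 w
  simp only [Function.comp_apply, id_eq, add_apply, smul_apply,
    ContinuousLinearMap.smulRight_apply, innerSL_apply_apply, ContinuousLinearMap.id_apply,
    Submodule.starProjection_orthogonal_val, Submodule.starProjection_singleton, smul_smul,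
    smul_eq_mul, RCLike.ofReal_real_eq_id, id_eq]
  match_scalars <;> field_simp

/-- The derivative of `radialExt f ‖v‖` on the ray through `v`: it maps `v` to `f v` and agrees with
the derivative of `f` on the tangent space at `v`. -/
noncomputable def radialDeriv (f : E → F) (v : E) : E →L[ℝ] F :=
  fderiv ℝ f v ∘L (ℝ ∙ v)ᗮ.starProjection + ((‖v‖ ^ 2)⁻¹ • innerSL ℝ v).smulRight (f v)

theorem hasFDerivAt_radialExt {f : E → F} {c : ℝ} (hc : 0 < c) {z : E} (hz : z ≠ 0)
    (hf : DifferentiableAt ℝ f (radialProj c z)) :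
    HasFDerivAt (radialExt f c) (radialDeriv f (radialProj c z)) z := by
  have hz' : ‖z‖ ≠ 0 := norm_ne_zero_iff.2 hz
  have hproj : (ℝ ∙ radialProj c z)ᗮ.starProjection = (ℝ ∙ z)ᗮ.starProjection := by
    simp only [radialProj,
      Submodule.span_singleton_smul_eq (IsUnit.mk0 _ (div_ne_zero hc.ne' hz')) z]
  refine (((hasFDerivAt_norm hz).mul_const c⁻¹).smul
    (hf.hasFDerivAt.comp z (hasFDerivAt_radialProj c hz))).congr_fderiv ?_
  ext1 w
  have hinner : inner ℝ (radialProj c z) w = c / ‖z‖ * inner ℝ z w := real_inner_smul_left _ _ _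
  simp only [radialDeriv, hproj, norm_radialProj hc.le hz, hinner, ContinuousLinearMap.comp_apply,
    ContinuousLinearMap.smulRight_apply, add_apply, smul_apply, innerSL_apply_apply, map_smul,
    smul_eq_mul, Function.comp_apply, smul_smul]
  match_scalars <;> field_simp

theorem radialDeriv_self (f : E → F) {v : E} (hv : v ≠ 0) : radialDeriv f v v = f v := by
  have hproj : (ℝ ∙ v)ᗮ.starProjection v = 0 :=
    Submodule.starProjection_orthogonalComplement_singleton_eq_zero v
  simp [radialDeriv, hproj, hv]

theorem radialDeriv_comp_subtype {n m : ℕ}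
    (f : EuclideanSpace ℝ (Fin n) → EuclideanSpace ℝ (Fin m)) (v : EuclideanSpace ℝ (Fin n)) :
    (radialDeriv f v).toLinearMap ∘ₗ (sphereTangent v).subtype = sphereJacobian f v := by
  ext1 w
  have hw : inner ℝ v (w : EuclideanSpace ℝ (Fin n)) = 0 :=
    Submodule.mem_orthogonal_singleton_iff_inner_right.1 w.2
  simp [radialDeriv, sphereJacobian, hw, Submodule.starProjection_eq_self_iff.2 w.2]

theorem abs_det_radialDeriv_mul_norm_le {n : ℕ}
    (f : EuclideanSpace ℝ (Fin n) → EuclideanSpace ℝ (Fin n)) (v : EuclideanSpace ℝ (Fin n)) :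
    |(radialDeriv f v).det| * ‖v‖ ≤ ‖f v‖ * (sphereJacobian f v).normDet := by
  obtain rfl | hv := eq_or_ne v 0
  · simpa using mul_nonneg (norm_nonneg (f 0)) (sphereJacobian f 0).normDet_nonneg
  · simpa only [radialDeriv_comp_subtype, ContinuousLinearMap.coe_coe, radialDeriv_self f hv]
      using abs_det_mul_norm_le (radialDeriv f v).toLinearMap v

end RadialDerivative

section AreaInequality

variable {n : ℕ} {f : EuclideanSpace ℝ (Fin n) → EuclideanSpace ℝ (Fin n)} {a b : ℝ}
  {s : Set (EuclideanSpace ℝ (Fin n))}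

theorem sphereMeasure_image_le_setLIntegral_normDet (ha : 0 < a) (hb : 0 < b)
    (hs : MeasurableSet s) (hfs : MeasurableSet (f '' s)) (hsa : ∀ v ∈ s, ‖v‖ = a)
    (hsb : ∀ v ∈ s, ‖f v‖ = b) (hf : ∀ v ∈ s, DifferentiableAt ℝ f v) :
    sphereMeasure n b (f '' s) ≤
      ∫⁻ v in s, ENNReal.ofReal (sphereJacobian f v).normDet ∂sphereMeasure n a := by
  have hcone : MeasurableSet (sphereCone a s) := measurableSet_sphereCone a hs
  have hderiv : ∀ z ∈ sphereCone a s, HasFDerivWithinAt (radialExt f a)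
      (radialDeriv f (radialProj a z)) (sphereCone a s) z := fun z hz =>
    (hasFDerivAt_radialExt ha hz.2.2 (hf _ hz.1)).hasFDerivWithinAt
  have hdet : ∀ v ∈ s, ENNReal.ofReal |(radialDeriv f v).det| ≤
      ENNReal.ofReal (b / a) * ENNReal.ofReal (sphereJacobian f v).normDet := fun v hv => by
    rw [← ENNReal.ofReal_mul (by positivity), div_mul_eq_mul_div]
    refine ENNReal.ofReal_le_ofReal ((le_div_iff₀ ha).2 ?_)
    simpa only [hsa v hv, hsb v hv] using abs_det_radialDeriv_mul_norm_le f v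
  have hconst : ENNReal.ofReal (n / b) * ENNReal.ofReal (b / a) = ENNReal.ofReal (n / a) := by
    rw [← ENNReal.ofReal_mul (by positivity), div_mul_div_cancel₀ hb.ne']
  calc sphereMeasure n b (f '' s)
      = ENNReal.ofReal (n / b) * volume (sphereCone b (f '' s)) := sphereMeasure_apply hb hfs
    _ ≤ ENNReal.ofReal (n / b) * volume (radialExt f a '' sphereCone a s) := by
        gcongr
        exact sphereCone_image_subset ha hb hsa
    _ ≤ ENNReal.ofReal (n / b) *
          ∫⁻ z in sphereCone a s, ENNReal.ofReal |(radialDeriv f (radialProj a z)).det| := by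
        gcongr
        exact addHaar_image_le_lintegral_abs_det_fderiv volume hcone hderiv
    _ ≤ ENNReal.ofReal (n / b) * ∫⁻ z in sphereCone a s,
          ENNReal.ofReal (b / a) *
            ENNReal.ofReal (sphereJacobian f (radialProj a z)).normDet := by
        gcongr ENNReal.ofReal (n / b) * ?_
        exact setLIntegral_mono' hcone fun z hz => hdet _ hz.1
    _ = ENNReal.ofReal (n / a) * ∫⁻ z in sphereCone a s,
          ENNReal.ofReal (sphereJacobian f (radialProj a z)).normDet := by
        rw [lintegral_const_mul' _ _ ENNReal.ofReal_ne_top, ← mul_assoc, hconst]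
    _ = ∫⁻ v in s, ENNReal.ofReal (sphereJacobian f v).normDet ∂sphereMeasure n a :=
        (setLIntegral_sphereMeasure ha hs (measurable_normDet_sphereJacobian f).ennreal_ofReal).symm

theorem measurableSet_inter_preimage_of_continuousOn {X Y : Type*} [TopologicalSpace X]
    [MeasurableSpace X] [OpensMeasurableSpace X] [TopologicalSpace Y] [MeasurableSpace Y]
    [BorelSpace Y] {f : X → Y} {s : Set X} (hf : ContinuousOn f s) (hs : MeasurableSet s)
    {t : Set Y} (ht : MeasurableSet t) : MeasurableSet (s ∩ f ⁻¹' t) := by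
  rw [← Subtype.image_preimage_coe]
  exact hs.subtype_image ((continuousOn_iff_continuous_domRestrict.1 hf).measurable ht)

theorem restrict_sphereMeasure_image_le_map_withDensity (ha : 0 < a) (hb : 0 < b)
    (hs : IsCompact s) (hsa : ∀ v ∈ s, ‖v‖ = a) (hsb : ∀ v ∈ s, ‖f v‖ = b)
    (hf : ∀ v ∈ s, DifferentiableAt ℝ f v) :
    (sphereMeasure n b).restrict (f '' s) ≤
      (((sphereMeasure n a).restrict s).withDensity
        fun v => ENNReal.ofReal (sphereJacobian f v).normDet).map f := by
  have hfs : ContinuousOn f s := fun v hv => (hf v hv).continuousAt.continuousWithinAt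
  have hfm := (hfs.aemeasurable (μ := sphereMeasure n a) hs.measurableSet).mono_ac
    (withDensity_absolutelyContinuous _ fun v => ENNReal.ofReal (sphereJacobian f v).normDet)
  refine Measure.le_iff.2 fun t ht => ?_
  have himage : t ∩ f '' s = f '' (s ∩ f ⁻¹' t) := by
    rw [Set.image_inter_preimage, Set.inter_comm]
  have hst : MeasurableSet (s ∩ f ⁻¹' t) :=
    measurableSet_inter_preimage_of_continuousOn hfs hs.measurableSet ht
  have himage_meas : MeasurableSet (f '' (s ∩ f ⁻¹' t)) :=
    himage ▸ ht.inter (hs.image_of_continuousOn hfs).measurableSet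
  rw [Measure.restrict_apply ht, himage, Measure.map_apply_of_aemeasurable hfm ht,
    withDensity_apply' _, Measure.restrict_restrict' hs.measurableSet, Set.inter_comm _ s]
  exact sphereMeasure_image_le_setLIntegral_normDet ha hb hst himage_meas
    (fun v hv => hsa v hv.1) (fun v hv => hsb v hv.1) (fun v hv => hf v hv.1)

theorem setLIntegral_image_sphereMeasure_le (ha : 0 < a) (hb : 0 < b)
    (hs : IsCompact s) (hsa : ∀ v ∈ s, ‖v‖ = a) (hsb : ∀ v ∈ s, ‖f v‖ = b)
    (hf : ∀ v ∈ s, DifferentiableAt ℝ f v) {q : EuclideanSpace ℝ (Fin n) → ℝ≥0∞}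
    (hq : Measurable q) :
    ∫⁻ y in f '' s, q y ∂sphereMeasure n b ≤
      ∫⁻ v in s, q (f v) * ENNReal.ofReal (sphereJacobian f v).normDet ∂sphereMeasure n a := by
  have hfs : ContinuousOn f s := fun v hv => (hf v hv).continuousAt.continuousWithinAt
  have hfm := hfs.aemeasurable (μ := sphereMeasure n a) hs.measurableSet
  have hJ : Measurable fun v => ENNReal.ofReal (sphereJacobian f v).normDet :=
    (measurable_normDet_sphereJacobian f).ennreal_ofReal
  calc ∫⁻ y in f '' s, q y ∂sphereMeasure n b
      ≤ ∫⁻ y, q y ∂(((sphereMeasure n a).restrict s).withDensity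
          fun v => ENNReal.ofReal (sphereJacobian f v).normDet).map f :=
        lintegral_mono'
          (restrict_sphereMeasure_image_le_map_withDensity ha hb hs hsa hsb hf) le_rfl
    _ = ∫⁻ v, q (f v) ∂((sphereMeasure n a).restrict s).withDensity
          fun v => ENNReal.ofReal (sphereJacobian f v).normDet :=
        lintegral_map' hq.aemeasurable (hfm.mono_ac (withDensity_absolutelyContinuous _ _))
    _ = ∫⁻ v in s, q (f v) * ENNReal.ofReal (sphereJacobian f v).normDet ∂sphereMeasure n a := by
        refine (lintegral_withDensity_eq_lintegral_mul₀ hJ.aemeasurable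
          (hq.comp_aemeasurable hfm)).trans ?_
        simp only [Pi.mul_apply, Function.comp_apply, mul_comm]

end AreaInequality

section Densities

variable {Ω : Type*} [MeasurableSpace Ω] {P : Measure Ω} {n : ℕ}
  {f : EuclideanSpace ℝ (Fin n) → EuclideanSpace ℝ (Fin n)} {X : Ω → EuclideanSpace ℝ (Fin n)}
  {a b : ℝ}

theorem map_le_setLIntegral_pdf_mul_normDet (ha : 0 < a) (hb : 0 < b) (hX : AEMeasurable X P)
    [HasPDF (fun ω => f (X ω)) P (sphereMeasure n b)] {K : Set (EuclideanSpace ℝ (Fin n))}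
    (hK : IsCompact K) (hKa : ∀ v ∈ K, ‖v‖ = a) (hKb : ∀ v ∈ K, ‖f v‖ = b)
    (hf : ∀ v ∈ K, DifferentiableAt ℝ f v) :
    P.map X K ≤ ∫⁻ v in K, pdf (fun ω => f (X ω)) P (sphereMeasure n b) (f v) *
      ENNReal.ofReal (sphereJacobian f v).normDet ∂sphereMeasure n a := by
  have hfK : MeasurableSet (f '' K) := (hK.image_of_continuousOn fun v hv =>
    (hf v hv).continuousAt.continuousWithinAt).measurableSet
  calc P.map X K = P (X ⁻¹' K) := Measure.map_apply_of_aemeasurable hX hK.measurableSet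
    _ ≤ P ((fun ω => f (X ω)) ⁻¹' (f '' K)) := measure_mono fun ω => Set.mem_image_of_mem f
    _ = P.map (fun ω => f (X ω)) (f '' K) := (Measure.map_apply_of_aemeasurable
        (HasPDF.aemeasurable _ P (sphereMeasure n b)) hfK).symm
    _ = ∫⁻ y in f '' K, pdf (fun ω => f (X ω)) P (sphereMeasure n b) y ∂sphereMeasure n b :=
        map_eq_setLIntegral_pdf _ P _ hfK
    _ ≤ _ := setLIntegral_image_sphereMeasure_le ha hb hK hKa hKb hf (measurable_pdf _ _ _)

theorem ae_pdf_le_pdf_mul_normDet [IsFiniteMeasure P] (ha : 0 < a) (hb : 0 < b)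
    [HasPDF X P (sphereMeasure n a)] [HasPDF (fun ω => f (X ω)) P (sphereMeasure n b)]
    (hf : ∀ᵐ ω ∂P, DifferentiableAt ℝ f (X ω)) (hXa : ∀ᵐ ω ∂P, ‖X ω‖ = a)
    (hfb : ∀ᵐ ω ∂P, ‖f (X ω)‖ = b) :
    ∀ᵐ ω ∂P, pdf X P (sphereMeasure n a) (X ω) ≤
      pdf (fun ω => f (X ω)) P (sphereMeasure n b) (f (X ω)) *
        ENNReal.ofReal (sphereJacobian f (X ω)).normDet := by
  set p := pdf X P (sphereMeasure n a)
  set q := pdf (fun ω => f (X ω)) P (sphereMeasure n b)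
  have hXm : AEMeasurable X P := HasPDF.aemeasurable X P (sphereMeasure n a)
  let U := {v | DifferentiableAt ℝ f v} ∩ f ⁻¹' Metric.sphere 0 b ∩ Metric.sphere 0 a
  have hU : MeasurableSet U := (measurableSet_inter_preimage_of_continuousOn
    (fun v hv => (DifferentiableAt.continuousAt (𝕜 := ℝ) hv).continuousWithinAt)
    (measurableSet_of_differentiableAt ℝ f) Metric.isClosed_sphere.measurableSet).inter
    Metric.isClosed_sphere.measurableSet
  have hle : p ≤ᵐ[(sphereMeasure n a).restrict U]
      fun v => q (f v) * ENNReal.ofReal (sphereJacobian f v).normDet := by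
    refine ae_le_of_forall_setLIntegral_le_of_sigmaFinite (measurable_pdf _ _ _) fun s hs _ => ?_
    rw [Measure.restrict_restrict hs, ← map_eq_setLIntegral_pdf X P _ (hs.inter hU),
      (hs.inter hU).measure_eq_iSup_isCompact]
    refine iSup₂_le fun K hKs => iSup_le fun hK => ?_
    exact (map_le_setLIntegral_pdf_mul_normDet ha hb hXm hK
      (fun v hv => mem_sphere_zero_iff_norm.1 (hKs hv).2.2)
      (fun v hv => mem_sphere_zero_iff_norm.1 (hKs hv).2.1.2)
      (fun v hv => (hKs hv).2.1.1)).trans (lintegral_mono_set hKs)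
  have hleX : ∀ᵐ ω ∂P, X ω ∈ U →
      p (X ω) ≤ q (f (X ω)) * ENNReal.ofReal (sphereJacobian f (X ω)).normDet :=
    ae_of_ae_map hXm (HasPDF.absolutelyContinuous'.ae_le ((ae_restrict_iff' hU).1 hle))
  filter_upwards [hleX, hf, hXa, hfb] with ω hω hdiff hnorm hnorm_image
  exact hω ⟨⟨hdiff, mem_sphere_zero_iff_norm.2 hnorm_image⟩, mem_sphere_zero_iff_norm.2 hnorm⟩

end Densities

section Entropy

variable {Ω E : Type*} [MeasurableSpace Ω] {P : Measure Ω} [MeasurableSpace E]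

theorem ae_toReal_pdf_pos [IsFiniteMeasure P] (X : Ω → E) (ν : Measure E) [HasPDF X P ν] :
    ∀ᵐ ω ∂P, 0 < (pdf X P ν (X ω)).toReal := by
  refine ae_of_ae_map (HasPDF.aemeasurable X P ν) (p := fun v => 0 < (pdf X P ν v).toReal) ?_
  rw [map_eq_withDensity_pdf X P ν, ae_withDensity_iff (measurable_pdf X P ν)]
  have hlt : ∀ᵐ v ∂ν, pdf X P ν v < ∞ := pdf.ae_lt_top
  filter_upwards [hlt] with v hv hv0
  exact ENNReal.toReal_pos hv0 hv.ne

theorem ae_pdf_rpow_eq_ofReal_exp_infoContent [IsFiniteMeasure P] (X : Ω → E) (ν : Measure E)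
    [HasPDF X P ν] (r : ℝ) :
    ∀ᵐ ω ∂P, pdf X P ν (X ω) ^ (-r) = ENNReal.ofReal (Real.exp (r * infoContent X P ν ω)) := by
  filter_upwards [ae_toReal_pdf_pos X ν] with ω hω
  rw [infoContent, mul_neg, ← neg_mul, mul_comm, ← Real.rpow_def_of_pos hω,
    ← ENNReal.ofReal_rpow_of_pos hω, ENNReal.ofReal_toReal (ENNReal.toReal_pos_iff.1 hω).2.ne]

theorem ofReal_exp_integral_le_lintegral [IsProbabilityMeasure P] {f : Ω → ℝ}
    (hf : Integrable f P) :
    ENNReal.ofReal (Real.exp (∫ ω, f ω ∂P)) ≤ ∫⁻ ω, ENNReal.ofReal (Real.exp (f ω)) ∂P := by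
  have hexp : AEStronglyMeasurable (fun ω => Real.exp (f ω)) P :=
    Real.continuous_exp.comp_aestronglyMeasurable hf.1
  have hexp_nonneg : 0 ≤ᵐ[P] fun ω => Real.exp (f ω) := ae_of_all P fun ω => (Real.exp_pos _).le
  obtain htop | hfin := eq_or_ne (∫⁻ ω, ENNReal.ofReal (Real.exp (f ω)) ∂P) ∞
  · exact htop ▸ le_top
  · have hint : Integrable (fun ω => Real.exp (f ω)) P :=
      (lintegral_ofReal_ne_top_iff_integrable hexp hexp_nonneg).1 hfin
    rw [← ofReal_integral_eq_lintegral_ofReal hint hexp_nonneg]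
    exact ENNReal.ofReal_le_ofReal <| convexOn_exp.map_integral_le
      Real.continuous_exp.continuousOn isClosed_univ (ae_of_all P fun _ => Set.mem_univ _) hf hint

end Entropy

section MeanSingularValue

variable {Ω : Type*} [MeasurableSpace Ω] {P : Measure Ω} {d : ℕ}
  {f : EuclideanSpace ℝ (Fin (d + 1)) → EuclideanSpace ℝ (Fin (d + 1))}
  {X : Ω → EuclideanSpace ℝ (Fin (d + 1))} {a b : ℝ}

theorem ae_pdf_rpow_le_pdf_rpow_mul_meanSV [IsFiniteMeasure P] (hd : 0 < d) (ha : 0 < a)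
    (hb : 0 < b) [HasPDF X P (sphereMeasure (d + 1) a)]
    [HasPDF (fun ω => f (X ω)) P (sphereMeasure (d + 1) b)]
    (hf : ∀ᵐ ω ∂P, DifferentiableAt ℝ f (X ω)) (hXa : ∀ᵐ ω ∂P, ‖X ω‖ = a)
    (hfb : ∀ᵐ ω ∂P, ‖f (X ω)‖ = b) :
    ∀ᵐ ω ∂P, pdf (fun ω => f (X ω)) P (sphereMeasure (d + 1) b) (f (X ω)) ^ (-(1 / d : ℝ)) ≤
      pdf X P (sphereMeasure (d + 1) a) (X ω) ^ (-(1 / d : ℝ)) *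
        ENNReal.ofReal (meanSV (sphereJacobian f (X ω))) := by
  have hd' : (0 : ℝ) < 1 / d := by positivity
  filter_upwards [ae_pdf_le_pdf_mul_normDet ha hb hf hXa hfb, hXa,
    ae_toReal_pdf_pos X (sphereMeasure (d + 1) a)] with ω hle hnorm hpos
  have hX0 : X ω ≠ 0 := norm_ne_zero_iff.1 (hnorm.trans_ne ha.ne')
  have hamgm : (sphereJacobian f (X ω)).normDet ^ (1 / d : ℝ) ≤
      meanSV (sphereJacobian f (X ω)) := by
    have := nontrivial_sphereTangent (by lia) hX0
    simpa only [finrank_sphereTangent hX0, Nat.add_sub_cancel]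
      using normDet_rpow_le_meanSV (sphereJacobian f (X ω))
  rw [ENNReal.rpow_neg, ENNReal.rpow_neg, mul_comm, ← div_eq_mul_inv,
    ENNReal.le_div_iff_mul_le (Or.inl (by simp [(ENNReal.toReal_pos_iff.1 hpos).1.ne']))
      (Or.inr ENNReal.ofReal_ne_top), mul_comm, ← div_eq_mul_inv]
  refine ENNReal.div_le_of_le_mul' ?_
  calc pdf X P (sphereMeasure (d + 1) a) (X ω) ^ (1 / d : ℝ)
      ≤ (pdf (fun ω => f (X ω)) P (sphereMeasure (d + 1) b) (f (X ω)) *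
          ENNReal.ofReal (sphereJacobian f (X ω)).normDet) ^ (1 / d : ℝ) :=
        ENNReal.rpow_le_rpow hle hd'.le
    _ = pdf (fun ω => f (X ω)) P (sphereMeasure (d + 1) b) (f (X ω)) ^ (1 / d : ℝ) *
          ENNReal.ofReal ((sphereJacobian f (X ω)).normDet ^ (1 / d : ℝ)) := by
        rw [ENNReal.mul_rpow_of_nonneg _ _ hd'.le,
          ENNReal.ofReal_rpow_of_nonneg (LinearMap.normDet_nonneg _) hd'.le]
    _ ≤ _ := by gcongr

theorem ofReal_exp_entropy_sub_le_lintegral_meanSV [IsProbabilityMeasure P] (hd : 0 < d)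
    (ha : 0 < a) (hb : 0 < b) [HasPDF X P (sphereMeasure (d + 1) a)]
    [HasPDF (fun ω => f (X ω)) P (sphereMeasure (d + 1) b)]
    (hf : ∀ᵐ ω ∂P, DifferentiableAt ℝ f (X ω)) (hXa : ∀ᵐ ω ∂P, ‖X ω‖ = a)
    (hfb : ∀ᵐ ω ∂P, ‖f (X ω)‖ = b) (hHX : HasEntropy X P (sphereMeasure (d + 1) a))
    (hHf : HasEntropy (fun ω => f (X ω)) P (sphereMeasure (d + 1) b)) :
    ENNReal.ofReal (Real.exp (1 / d * (entropy (fun ω => f (X ω)) P (sphereMeasure (d + 1) b) -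
      entropy X P (sphereMeasure (d + 1) a)))) ≤
      ∫⁻ ω, ENNReal.ofReal (meanSV (sphereJacobian f (X ω))) ∂P := by
  have hjensen := ofReal_exp_integral_le_lintegral ((hHf.sub hHX).const_mul (1 / (d : ℝ)))
  rw [integral_const_mul, integral_sub' hHf hHX] at hjensen
  refine hjensen.trans (lintegral_mono_ae ?_)
  filter_upwards [ae_pdf_rpow_le_pdf_rpow_mul_meanSV hd ha hb hf hXa hfb,
    ae_pdf_rpow_eq_ofReal_exp_infoContent X (sphereMeasure (d + 1) a) (1 / d),
    ae_pdf_rpow_eq_ofReal_exp_infoContent (fun ω => f (X ω)) (sphereMeasure (d + 1) b) (1 / d)]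
    with ω hle hpX hpf
  rw [hpX, hpf] at hle
  rw [Pi.sub_apply, mul_sub, Real.exp_sub, ENNReal.ofReal_div_of_pos (Real.exp_pos _)]
  exact ENNReal.div_le_of_le_mul' hle

theorem expEntropy_le_expEntropy_mul_lintegral_meanSV [IsFiniteMeasure P] (hd : 0 < d)
    (ha : 0 < a) (hb : 0 < b) [HasPDF X P (sphereMeasure (d + 1) a)]
    [HasPDF (fun ω => f (X ω)) P (sphereMeasure (d + 1) b)]
    (hf : ∀ᵐ ω ∂P, DifferentiableAt ℝ f (X ω)) (hXa : ∀ᵐ ω ∂P, ‖X ω‖ = a)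
    (hfb : ∀ᵐ ω ∂P, ‖f (X ω)‖ = b)
    (hind : IndepFun (fun ω => pdf X P (sphereMeasure (d + 1) a) (X ω))
      (fun ω (i : ℕ) => (sphereJacobian f (X ω)).singularValues i) P) :
    expEntropy d (fun ω => f (X ω)) P (sphereMeasure (d + 1) b) ≤
      expEntropy d X P (sphereMeasure (d + 1) a) *
        ∫⁻ ω, ENNReal.ofReal (meanSV (sphereJacobian f (X ω))) ∂P := by
  have hX : AEMeasurable X P := HasPDF.aemeasurable X P (sphereMeasure (d + 1) a)
  have hmean : (fun ω => ENNReal.ofReal ((∑ i ∈ Finset.range d,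
      (sphereJacobian f (X ω)).singularValues i) / d)) =ᵐ[P]
      fun ω => ENNReal.ofReal (meanSV (sphereJacobian f (X ω))) := by
    filter_upwards [hXa] with ω hnorm
    rw [meanSV, finrank_sphereTangent (norm_ne_zero_iff.1 (hnorm.trans_ne ha.ne')),
      Nat.add_sub_cancel]
  have hind' : IndepFun (fun ω => pdf X P (sphereMeasure (d + 1) a) (X ω) ^ (-(1 / (d : ℝ))))
      (fun ω => ENNReal.ofReal (meanSV (sphereJacobian f (X ω)))) P := by
    have hpow : Measurable fun t : ℝ≥0∞ => t ^ (-(1 / (d : ℝ))) := by fun_prop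
    have hsum : Measurable fun s : ℕ → ℝ => ENNReal.ofReal ((∑ i ∈ Finset.range d, s i) / d) := by
      fun_prop
    exact (hind.comp hpow hsum).congr (ae_eq_refl _) hmean
  calc expEntropy d (fun ω => f (X ω)) P (sphereMeasure (d + 1) b)
      ≤ ∫⁻ ω, pdf X P (sphereMeasure (d + 1) a) (X ω) ^ (-(1 / d : ℝ)) *
          ENNReal.ofReal (meanSV (sphereJacobian f (X ω))) ∂P :=
        lintegral_mono_ae (ae_pdf_rpow_le_pdf_rpow_mul_meanSV hd ha hb hf hXa hfb)
    _ = expEntropy d X P (sphereMeasure (d + 1) a) *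
          ∫⁻ ω, ENNReal.ofReal (meanSV (sphereJacobian f (X ω))) ∂P :=
        lintegral_mul_eq_lintegral_mul_lintegral_of_indepFun'
          (((measurable_pdf X P _).comp_aemeasurable hX).pow_const _)
          ((measurable_meanSV_sphereJacobian f).comp_aemeasurable hX).ennreal_ofReal hind'

end MeanSingularValue

section GradientScale

/-- The gradient scale coefficient at `v` of a map `f` between Euclidean spaces whose argument
varies in the hypersphere through `v`; `NeuralNetwork.gsc` is that of `f_l` as a function of
`f_k`. -/
noncomputable def sphereGSC {n m : ℕ} (f : EuclideanSpace ℝ (Fin n) → EuclideanSpace ℝ (Fin m))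
    (v : EuclideanSpace ℝ (Fin n)) : ℝ :=
  qmNorm (sphereJacobian f v) * ‖v‖ / ‖f v‖

variable {Ω : Type*} [MeasurableSpace Ω] {P : Measure Ω} {n m d : ℕ}
  {f : EuclideanSpace ℝ (Fin n) → EuclideanSpace ℝ (Fin m)} {X : Ω → EuclideanSpace ℝ (Fin n)}
  {a b ε δ : ℝ}

theorem nullMeasurableSet_sqrt_le_stdSV_sphereJacobian (hX : AEMeasurable X P) (ε : ℝ) :
    NullMeasurableSet {ω | √(ε * (ε + 2 * meanSV (sphereJacobian f (X ω)))) ≤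
      stdSV (sphereJacobian f (X ω))} P :=
  hX.nullMeasurable <| measurableSet_le
    (((measurable_meanSV_sphereJacobian f).const_mul 2).const_add ε |>.const_mul ε).sqrt
    (measurable_stdSV_sphereJacobian f)

theorem ofReal_add_lintegral_meanSV_le_lintegral_qmNorm (hn : 1 < n)
    (hX : AEMeasurable X P) (hX0 : ∀ᵐ ω ∂P, X ω ≠ 0) (hε : 0 ≤ ε)
    (hδ : δ ≤ P.real {ω | √(ε * (ε + 2 * meanSV (sphereJacobian f (X ω)))) ≤
      stdSV (sphereJacobian f (X ω))}) :
    ENNReal.ofReal (ε * δ) + ∫⁻ ω, ENNReal.ofReal (meanSV (sphereJacobian f (X ω))) ∂P ≤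
      ∫⁻ ω, ENNReal.ofReal (qmNorm (sphereJacobian f (X ω))) ∂P := by
  set S := {ω | √(ε * (ε + 2 * meanSV (sphereJacobian f (X ω)))) ≤
    stdSV (sphereJacobian f (X ω))}
  have hS : NullMeasurableSet S P := nullMeasurableSet_sqrt_le_stdSV_sphereJacobian hX ε
  have hεδ : ENNReal.ofReal (ε * δ) ≤ ∫⁻ ω, S.indicator (fun _ => ENNReal.ofReal ε) ω ∂P := by
    rw [lintegral_indicator_const₀ hS, ENNReal.ofReal_mul hε]
    gcongr
    exact ENNReal.ofReal_le_of_le_toReal hδ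
  refine (add_le_add_left hεδ _).trans ?_
  rw [← lintegral_add_left' (aemeasurable_const.indicator₀ hS)]
  refine lintegral_mono_ae ?_
  filter_upwards [hX0] with ω hω
  have := nontrivial_sphereTangent hn hω
  by_cases hωS : ω ∈ S
  · rw [Set.indicator_of_mem hωS, ← ENNReal.ofReal_add hε (meanSV_nonneg _)]
    exact ENNReal.ofReal_le_ofReal (add_meanSV_le_qmNorm _ hωS)
  · rw [Set.indicator_of_notMem hωS, zero_add]
    exact ENNReal.ofReal_le_ofReal (meanSV_le_qmNorm _)

theorem lintegral_sphereGSC_eq (hab : 0 ≤ a / b) (hXa : ∀ᵐ ω ∂P, ‖X ω‖ = a)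
    (hfb : ∀ᵐ ω ∂P, ‖f (X ω)‖ = b) :
    ∫⁻ ω, ENNReal.ofReal (sphereGSC f (X ω)) ∂P =
      ENNReal.ofReal (a / b) * ∫⁻ ω, ENNReal.ofReal (qmNorm (sphereJacobian f (X ω))) ∂P := by
  rw [← lintegral_const_mul' _ _ ENNReal.ofReal_ne_top]
  refine lintegral_congr_ae ?_
  filter_upwards [hXa, hfb] with ω ha hb
  rw [sphereGSC, ha, hb, mul_div_assoc, mul_comm (qmNorm _), ENNReal.ofReal_mul hab]

theorem exp_mul_sub_log_sub_sub_log (hd : 0 < d) (ha : 0 < a) (hb : 0 < b) (s t : ℝ) :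
    Real.exp (1 / d * ((t - d * Real.log b) - (s - d * Real.log a))) =
      a / b * Real.exp (1 / d * (t - s)) := by
  have hd' : (d : ℝ) ≠ 0 := by positivity
  rw [← Real.exp_log (div_pos ha hb), ← Real.exp_add, Real.log_div ha.ne' hb.ne']
  congr 1
  field_simp
  ring

theorem div_ofReal_div_le_ofReal_div_mul (ha : 0 < a) (hb : 0 < b) {s t M : ℝ≥0∞}
    (h : t ≤ s * M) :
    (t / ENNReal.ofReal b) / (s / ENNReal.ofReal a) ≤ ENNReal.ofReal (a / b) * M := by
  have ha0 : ENNReal.ofReal a ≠ 0 := (ENNReal.ofReal_pos.2 ha).ne'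
  refine ENNReal.div_le_of_le_mul ?_
  calc t / ENNReal.ofReal b
      ≤ s * M / ENNReal.ofReal b := by gcongr
    _ = (ENNReal.ofReal a / ENNReal.ofReal a) * (s * M / ENNReal.ofReal b) := by
        rw [ENNReal.div_self ha0 ENNReal.ofReal_ne_top, one_mul]
    _ = ENNReal.ofReal (a / b) * M * (s / ENNReal.ofReal a) := by
        rw [ENNReal.ofReal_div_of_pos hb]
        simp only [div_eq_mul_inv]
        ring

theorem ofReal_add_exp_entropy_sub_le_lintegral_sphereGSC [IsProbabilityMeasure P] (hn : n = d + 1)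
    (hm : m = d + 1) (hd : 0 < d) (ha : 0 < a) (hb : 0 < b)
    [HasPDF X P (sphereMeasure n a)] [HasPDF (fun ω => f (X ω)) P (sphereMeasure m b)]
    (hf : ∀ᵐ ω ∂P, DifferentiableAt ℝ f (X ω)) (hXa : ∀ᵐ ω ∂P, ‖X ω‖ = a)
    (hfb : ∀ᵐ ω ∂P, ‖f (X ω)‖ = b) (hε : 0 ≤ ε)
    (hδ : δ ≤ P.real {ω | √(ε * (ε + 2 * meanSV (sphereJacobian f (X ω)))) ≤
      stdSV (sphereJacobian f (X ω))})
    (hHX : HasEntropy X P (sphereMeasure n a))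
    (hHf : HasEntropy (fun ω => f (X ω)) P (sphereMeasure m b)) :
    ENNReal.ofReal (a / b * (ε * δ) + Real.exp (1 / d *
      ((entropy (fun ω => f (X ω)) P (sphereMeasure m b) - d * Real.log b) -
        (entropy X P (sphereMeasure n a) - d * Real.log a)))) ≤
      ∫⁻ ω, ENNReal.ofReal (sphereGSC f (X ω)) ∂P := by
  subst hn hm
  have hab : 0 ≤ a / b := (div_pos ha hb).le
  have hX0 : ∀ᵐ ω ∂P, X ω ≠ 0 := hXa.mono fun ω h => norm_ne_zero_iff.1 (h.trans_ne ha.ne')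
  rw [exp_mul_sub_log_sub_sub_log hd ha hb, ← mul_add, ENNReal.ofReal_mul hab,
    lintegral_sphereGSC_eq hab hXa hfb]
  gcongr
  calc ENNReal.ofReal (ε * δ + Real.exp (1 / d *
        (entropy (fun ω => f (X ω)) P (sphereMeasure (d + 1) b) -
          entropy X P (sphereMeasure (d + 1) a))))
      ≤ ENNReal.ofReal (ε * δ) + ENNReal.ofReal (Real.exp (1 / d *
          (entropy (fun ω => f (X ω)) P (sphereMeasure (d + 1) b) -
            entropy X P (sphereMeasure (d + 1) a)))) := ENNReal.ofReal_add_le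
    _ ≤ ENNReal.ofReal (ε * δ) +
          ∫⁻ ω, ENNReal.ofReal (meanSV (sphereJacobian f (X ω))) ∂P := by
        gcongr
        exact ofReal_exp_entropy_sub_le_lintegral_meanSV hd ha hb hf hXa hfb hHX hHf
    _ ≤ ∫⁻ ω, ENNReal.ofReal (qmNorm (sphereJacobian f (X ω))) ∂P :=
        ofReal_add_lintegral_meanSV_le_lintegral_qmNorm (by lia)
          (HasPDF.aemeasurable X P (sphereMeasure (d + 1) a)) hX0 hε hδ

theorem ofReal_add_expEntropy_div_le_lintegral_sphereGSC [IsFiniteMeasure P] (hn : n = d + 1)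
    (hm : m = d + 1) (hd : 0 < d) (ha : 0 < a) (hb : 0 < b)
    [HasPDF X P (sphereMeasure n a)] [HasPDF (fun ω => f (X ω)) P (sphereMeasure m b)]
    (hf : ∀ᵐ ω ∂P, DifferentiableAt ℝ f (X ω)) (hXa : ∀ᵐ ω ∂P, ‖X ω‖ = a)
    (hfb : ∀ᵐ ω ∂P, ‖f (X ω)‖ = b) (hε : 0 ≤ ε)
    (hδ : δ ≤ P.real {ω | √(ε * (ε + 2 * meanSV (sphereJacobian f (X ω)))) ≤
      stdSV (sphereJacobian f (X ω))})
    (hind : IndepFun (fun ω => pdf X P (sphereMeasure n a) (X ω))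
      (fun ω (i : ℕ) => (sphereJacobian f (X ω)).singularValues i) P) :
    ENNReal.ofReal (a / b * (ε * δ)) +
        (expEntropy d (fun ω => f (X ω)) P (sphereMeasure m b) / ENNReal.ofReal b) /
          (expEntropy d X P (sphereMeasure n a) / ENNReal.ofReal a) ≤
      ∫⁻ ω, ENNReal.ofReal (sphereGSC f (X ω)) ∂P := by
  subst hn hm
  have hab : 0 ≤ a / b := (div_pos ha hb).le
  have hX0 : ∀ᵐ ω ∂P, X ω ≠ 0 := hXa.mono fun ω h => norm_ne_zero_iff.1 (h.trans_ne ha.ne')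
  calc ENNReal.ofReal (a / b * (ε * δ)) +
        (expEntropy d (fun ω => f (X ω)) P (sphereMeasure (d + 1) b) / ENNReal.ofReal b) /
          (expEntropy d X P (sphereMeasure (d + 1) a) / ENNReal.ofReal a)
      ≤ ENNReal.ofReal (a / b * (ε * δ)) + ENNReal.ofReal (a / b) *
          ∫⁻ ω, ENNReal.ofReal (meanSV (sphereJacobian f (X ω))) ∂P := by
        gcongr
        exact div_ofReal_div_le_ofReal_div_mul ha hb
          (expEntropy_le_expEntropy_mul_lintegral_meanSV hd ha hb hf hXa hfb hind)
    _ = ENNReal.ofReal (a / b) * (ENNReal.ofReal (ε * δ) +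
          ∫⁻ ω, ENNReal.ofReal (meanSV (sphereJacobian f (X ω))) ∂P) := by
        rw [ENNReal.ofReal_mul hab, mul_add]
    _ ≤ ENNReal.ofReal (a / b) *
          ∫⁻ ω, ENNReal.ofReal (qmNorm (sphereJacobian f (X ω))) ∂P := by
        gcongr
        exact ofReal_add_lintegral_meanSV_le_lintegral_qmNorm (by lia)
          (HasPDF.aemeasurable X P (sphereMeasure (d + 1) a)) hX0 hε hδ
    _ = ∫⁻ ω, ENNReal.ofReal (sphereGSC f (X ω)) ∂P :=
        (lintegral_sphereGSC_eq hab hXa hfb).symm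

end GradientScale

namespace NeuralNetwork

variable (N : NeuralNetwork) (θ : ∀ l, N.Param l) (l : ℕ)

theorem between_succ_self : N.between θ l (l + 1) (Nat.le_succ l) = N.layer l (θ l) := by
  rw [N.between_succ θ l l le_rfl, between_self, Function.id_comp]

theorem between_eq_layer_comp (k : ℕ) (h : l + 1 ≤ k) :
    N.between θ l k ((Nat.le_succ l).trans h) = N.layer l (θ l) ∘ N.between θ (l + 1) k h := by
  induction k, h using Nat.le_induction with
  | base => rw [N.between_self, Function.comp_id, N.between_succ_self]
  | succ k hk ih =>
    rw [N.between_succ θ l k ((Nat.le_succ l).trans hk), ih, N.between_succ θ (l + 1) k hk,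
      Function.comp_assoc]

theorem act_eq_layer_act (hl : l + 1 ≤ N.depth + 1) (x : N.Space (N.depth + 1)) :
    N.act θ l ((Nat.le_succ l).trans hl) x = N.layer l (θ l) (N.act θ (l + 1) hl x) :=
  congrFun (N.between_eq_layer_comp θ l (N.depth + 1) hl) x

theorem jacobian_succ_self (hl : l + 1 ≤ N.depth + 1) (x : N.Space (N.depth + 1)) :
    N.jacobian θ (l + 1) l (Nat.le_succ l) hl x =
      sphereJacobian (N.layer l (θ l)) (N.act θ (l + 1) hl x) := by
  rw [jacobian, N.between_succ_self]

theorem gsc_succ_self (hl : l + 1 ≤ N.depth + 1) (x : N.Space (N.depth + 1)) :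
    N.gsc θ (l + 1) l (Nat.le_succ l) hl x =
      sphereGSC (N.layer l (θ l)) (N.act θ (l + 1) hl x) := by
  rw [gsc, N.jacobian_succ_self, N.act_eq_layer_act θ l hl, sphereGSC]

end NeuralNetwork

theorem corollary2 {Ω : Type*} [MeasurableSpace Ω] (P : Measure Ω) [IsProbabilityMeasure P]
    -- the network, its fixed parameter and a random data input
    (N : NeuralNetwork) (θ : ∀ l, N.Param l)
    (x : Ω → N.Space (N.depth + 1)) (hx : AEMeasurable x P)
    -- the layer `f_l`, which acts on `f_{l+1}` and preserves the dimension
    (l : ℕ) (hl : l + 1 ≤ N.depth + 1)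
    (d : ℕ) (hd : 1 ≤ d) (hwIn : N.width (l + 1) = d + 1) (hwOut : N.width l = d + 1)
    -- the random activation vectors `f_{l+1}` and `f_l`
    (fIn : Ω → N.Space (l + 1)) (hfIn : ∀ ω, fIn ω = N.act θ (l + 1) hl (x ω))
    (fOut : Ω → N.Space l) (hfOut : ∀ ω, fOut ω = N.act θ l ((Nat.le_succ l).trans hl) (x ω))
    (hdiff : ∀ᵐ ω ∂P, DifferentiableAt ℝ (N.layer l (θ l)) (fIn ω))
    -- fixed activation lengths
    (cIn cOut : ℝ) (hcIn : 0 < cIn) (hcOut : 0 < cOut)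
    (hlenIn : ∀ᵐ ω ∂P, ‖fIn ω‖ = cIn) (hlenOut : ∀ᵐ ω ∂P, ‖fOut ω‖ = cOut)
    -- the activation vectors have densities on their `d`-dimensional hyperspheres
    (hpdfIn : HasPDF fIn P (sphereMeasure (N.width (l + 1)) cIn))
    (hpdfOut : HasPDF fOut P (sphereMeasure (N.width l) cOut))
    -- the Jacobian of `f_l` with respect to `f_{l+1}`, and the spread of its singular values
    (ε δ : ℝ) (hε : 0 ≤ ε)
    (hδ : δ ≤ P.real {ω |
      √(ε * (ε + 2 * meanSV (N.jacobian θ (l + 1) l (Nat.le_succ l) hl (x ω)))) ≤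
        stdSV (N.jacobian θ (l + 1) l (Nat.le_succ l) hl (x ω))}) :
    (HasEntropy fIn P (sphereMeasure (N.width (l + 1)) cIn) →
      HasEntropy fOut P (sphereMeasure (N.width l) cOut) →
      ENNReal.ofReal (cIn / cOut * (ε * δ) +
          Real.exp (1 / d *
            ((entropy fOut P (sphereMeasure (N.width l) cOut) - d * Real.log cOut) -
              (entropy fIn P (sphereMeasure (N.width (l + 1)) cIn) - d * Real.log cIn)))) ≤
        ∫⁻ ω, ENNReal.ofReal (N.gsc θ (l + 1) l (Nat.le_succ l) hl (x ω)) ∂P) ∧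
    (IndepFun
        (fun ω => pdf fIn P (sphereMeasure (N.width (l + 1)) cIn) (fIn ω))
        (fun ω (i : ℕ) => (N.jacobian θ (l + 1) l (Nat.le_succ l) hl (x ω)).singularValues i) P →
      ENNReal.ofReal (cIn / cOut * (ε * δ)) +
          (expEntropy d fOut P (sphereMeasure (N.width l) cOut) / ENNReal.ofReal cOut) /
            (expEntropy d fIn P (sphereMeasure (N.width (l + 1)) cIn) / ENNReal.ofReal cIn) ≤
        ∫⁻ ω, ENNReal.ofReal (N.gsc θ (l + 1) l (Nat.le_succ l) hl (x ω)) ∂P) := by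
  obtain rfl : fIn = fun ω => N.act θ (l + 1) hl (x ω) := funext hfIn
  obtain rfl : fOut = fun ω => N.layer l (θ l) (N.act θ (l + 1) hl (x ω)) :=
    funext fun ω => (hfOut ω).trans (N.act_eq_layer_act θ l hl (x ω))
  simp only [N.jacobian_succ_self] at hδ
  simp only [N.jacobian_succ_self, N.gsc_succ_self]
  exact ⟨fun hHIn hHOut => ofReal_add_exp_entropy_sub_le_lintegral_sphereGSC hwIn hwOut hd hcIn
      hcOut hdiff hlenIn hlenOut hε hδ hHIn hHOut,
    fun hind => ofReal_add_expEntropy_div_le_lintegral_sphereGSC hwIn hwOut hd hcIn hcOut hdiff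
      hlenIn hlenOut hε hδ hind⟩
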